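/- Let $n\ge 1$ and $r>0$, and let $S_r^{2n-1}=\{\omega\in\mathbb C^n:|\omega|=r\}$. Let $\mathcal C\subseteq\mathbb C^n$ be a complex cone (that is, $\lambda\mathcal C\subseteq\mathcal C$ for all $\lambda\in\mathbb C$) which is non-harmonic, i.e. not contained in the zero set of any nonzero homogeneous harmonic polynomial $P(z)=\sum_{\alpha,\beta}c_{\alpha\beta}z^\alpha\bar z^\beta$ (with complex coefficients, homogeneous and harmonic on $\mathbb C^n=\mathbb R^{2n}$). Let $\mu$ be a finite complex Borel measure on $\mathbb C^n$ which is supported on $S_r^{2n-1}$ and absolutely continuous with respect to the surface measure of $S_r^{2n-1}$. For $k\in\mathbb Z_+=\{0,1,2,\dots\}$ put $$\varphi_k^{n-1}(z)=L_k^{n-1}\!\left(\tfrac{|z|^2}{2}\right)e^{-|z|^2/4},\qquad L_k^{n-1}(x)=\sum_{j=0}^k\binom{n-1+k}{k-j}\frac{(-x)^j}{j!},$$ and let the spectral projections of $\mu$ be $$\varphi_k^{n-1}\times\mu(z)=\int_{S_r^{2n-1}}\varphi_k^{n-1}(z-\omega)\,e^{\frac i2\operatorname{Im}(z\cdot\bar\omega)}\,d\mu(\omega),\qquad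 z\in\mathbb C^n,$$ where $z\cdot\bar\omega=\sum_{j=1}^n z_j\bar\omega_j$. If $\varphi_k^{n-1}\times\mu(z)=0$ for every $z\in\mathcal C$ and every $k\in\mathbb Z_+$, then $\mu=0$. -/

import Mathlib

open MeasureTheory
open scoped ENNReal

noncomputable section

namespace SpectralProjection

/-- The space `ℂⁿ` with its Euclidean (Hermitian) norm. -/
abbrev CSpace (n : ℕ) : Type := EuclideanSpace ℂ (Fin n)

/-! ### Cones and harmonic polynomials -/

/-- A set `C ⊆ ℂⁿ` is a complex cone if `l • C ⊆ C` for every `l ∈ ℂ`. -/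
def IsComplexCone {n : ℕ} (C : Set (CSpace n)) : Prop :=
  ∀ l : ℂ, ∀ z ∈ C, l • z ∈ C

/-- Complex-valued polynomials on `ℂⁿ = ℝ²ⁿ`, written in the `2n` variables `z_j` (`Sum.inl j`)
and `\bar z_j` (`Sum.inr j`), i.e. `P(z) = ∑ c_{αβ} z^α \bar z^β`. -/
abbrev ZPoly (n : ℕ) : Type := MvPolynomial (Fin n ⊕ Fin n) ℂ

/-- The value `P(z) = ∑ c_{αβ} z^α \bar z^β`. -/
def ZPoly.value {n : ℕ} (P : ZPoly n) (z : CSpace n) : ℂ :=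
  MvPolynomial.eval (Sum.elim (fun j => z j) (fun j => (starRingEnd ℂ) (z j))) P

/-- The Euclidean Laplacian of `ℝ²ⁿ` in complex coordinates: since
`∂²/∂x_j² + ∂²/∂y_j² = 4 ∂²/∂z_j∂\bar z_j`, it is `Δ = 4 ∑_j ∂²/∂z_j∂\bar z_j`. -/
def ZPoly.laplacian {n : ℕ} (P : ZPoly n) : ZPoly n :=
  MvPolynomial.C 4 *
    ∑ j : Fin n, MvPolynomial.pderiv (Sum.inl j) (MvPolynomial.pderiv (Sum.inr j) P)

/-- `P` is a nonzero homogeneous harmonic polynomial of degree `l`. -/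
structure IsHomogeneousHarmonic {n : ℕ} (P : ZPoly n) (l : ℕ) : Prop where
  ne_zero : P ≠ 0
  homogeneous : P.IsHomogeneous l
  harmonic : P.laplacian = 0

/-- A set is non-harmonic if it is not contained in the zero set of any (nonzero) homogeneous
harmonic polynomial. -/
def IsNonHarmonic {n : ℕ} (C : Set (CSpace n)) : Prop :=
  ∀ (l : ℕ) (P : ZPoly n), IsHomogeneousHarmonic P l → ¬ C ⊆ {z | P.value z = 0}

/-! ### Laguerre functions -/

/-- The Laguerre polynomial `L_k^a(x) = ∑_{j=0}^k binom(a+k, k-j) (-x)^j / j!`, for `a ∈ ℕ`. -/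
def laguerrePoly (a k : ℕ) (x : ℝ) : ℝ :=
  ∑ j ∈ Finset.range (k + 1), ((a + k).choose (k - j) : ℝ) * (-x) ^ j / (j.factorial : ℝ)

/-- The Laguerre function `φ_k^a(z) = L_k^a(|z|²/2) e^{-|z|²/4}` on `ℂⁿ`. -/
def laguerreFun {n : ℕ} (a k : ℕ) (z : CSpace n) : ℝ :=
  laguerrePoly a k (‖z‖ ^ 2 / 2) * Real.exp (-‖z‖ ^ 2 / 4)

/-! ### Measures on spheres and their spectral projections -/

/-- The surface measure of the sphere of radius `r` centred at the origin of `ℂⁿ = ℝ²ⁿ`, as a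
measure on `ℂⁿ`: the image of the surface measure of the unit sphere under `ω ↦ r ω`, multiplied
by `r^{2n-1}`. -/
def surfaceMeasure (n : ℕ) (r : ℝ) : Measure (CSpace n) :=
  ENNReal.ofReal (r ^ (2 * n - 1)) •
    ((volume : Measure (CSpace n)).toSphere).map
      (fun ω : Metric.sphere (0 : CSpace n) 1 => r • (ω : CSpace n))

/-- The space `X(S_r)` of all finite complex Borel measures on `ℂⁿ` which are supported on the
sphere of radius `r` and absolutely continuous with respect to its surface measure. -/
structure MemX {n : ℕ} (r : ℝ) (μ : ComplexMeasure (CSpace n)) : Prop where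
  supported : ∀ A : Set (CSpace n), MeasurableSet A →
    Disjoint A (Metric.sphere (0 : CSpace n) r) → μ A = 0
  absolutelyContinuous :
    VectorMeasure.AbsolutelyContinuous μ (surfaceMeasure n r).toENNRealVectorMeasure

/-- The imaginary part of `z · \bar w = ∑_j z_j \bar w_j`. -/
def imDot {n : ℕ} (z w : CSpace n) : ℝ :=
  (∑ j : Fin n, z j * (starRingEnd ℂ) (w j)).im

/-- The spectral projection of a complex measure `μ` living on the sphere `S_r`:
`(φ_k^{n-1} × μ)(z) = ∫_{S_r} φ_k^{n-1}(z - ω) e^{(i/2) Im(z · \bar ω)} dμ(ω)`. The integral against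
the complex measure `μ` pairs complex values by multiplication. -/
def spectralProjection {n : ℕ} (r : ℝ) (k : ℕ) (μ : ComplexMeasure (CSpace n))
    (z : CSpace n) : ℂ :=
  VectorMeasure.integral (VectorMeasure.restrict μ (Metric.sphere (0 : CSpace n) r))
    (fun ω : CSpace n =>
      (laguerreFun (n - 1) k (z - ω) : ℂ) * Complex.exp (Complex.I / 2 * (imDot z ω : ℂ)))
    (ContinuousLinearMap.mul ℝ ℂ)

end SpectralProjection

end

open MeasureTheory
open scoped ENNReal

/-! Let `S` be the sphere, `Λ` integration against `μ` on the Banach algebra `C(S, ℂ)`, and `c(w) =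
∑ z_i \bar w_i`. Since `L_k` has degree exactly `k`, vanishing of all projections at `z` gives
`Λ(q^k g) = 0` for every `k`, where `q = |z - w|²/2` and `g` is the Gaussian times the twist.
Summing the exponential series gives `Λ(exp(-q) g) = 0`, which on the sphere says `Λ(exp(c + \bar
c/2)) = 0` (`exp_neg_halfSqDist_mul_expFactor`).

On a complex cone `z` may be replaced by `l z`. The modulus of `l` separates total degrees and its
argument separates bidegrees, so `Λ(c^j \bar c^m) = 0` for all `j`, `m` and all `z` in the cone
(`map_monomial_eq_zero_of_exp`).

As a function of `z`, this moment is a polynomial `P_{j,m}`, homogeneous of degree `j + m`. As `|w|²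
= r²` on the sphere, its Laplacian is `4 j m r² P_{j-1,m-1}`. So `P_{0,m}` is harmonic and vanishes
on the cone, hence is zero; inductively each `P_{j,m}` is harmonic, hence zero
(`moments_eq_zero_of_isNonHarmonic`). The Fourier transform of `μ` is a series in these moments, so
it vanishes and `μ = 0`. -/

namespace SpectralProjection

/-! ### Exponentials and powers under a continuous functional -/

section BanachAlgebra

variable {A : Type*} [NormedCommRing A] [NormedAlgebra ℂ A] [CompleteSpace A]

open NormedSpace in
/-- A functional vanishing on `exp (t x)` for all real `t` vanishes on all powers of `x`. -/
theorem map_pow_eq_zero_of_exp (Λ : A →L[ℂ] ℂ) (x : A)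
    (h : ∀ t : ℝ, Λ (exp ((t : ℂ) • x)) = 0) (N : ℕ) : Λ (x ^ N) = 0 := by
  let _ : NormedAlgebra ℝ A := NormedAlgebra.restrictScalars ℝ ℂ A
  have h1 : HasFPowerSeriesAt (exp : A → A) (expSeries ℝ A)
      ((ContinuousLinearMap.toSpanSingleton ℝ x) 0) := by
    simpa using exp_hasFPowerSeriesAt_zero (𝕂 := ℝ) (𝔸 := A)
  obtain ⟨r, hr⟩ := h1.compContinuousLinearMap (u := ContinuousLinearMap.toSpanSingleton ℝ x)
  have h2 := (Λ.restrictScalars ℝ).comp_hasFPowerSeriesOnBall hr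
  have h3 : (⇑(Λ.restrictScalars ℝ) ∘ exp ∘ ⇑(ContinuousLinearMap.toSpanSingleton ℝ x)) = 0 := by
    ext t
    simpa using h t
  rw [h3] at h2
  -- The zero function `t ↦ Λ (exp (t x))` has Taylor coefficients `Λ (x ^ N) / N!` at `0`.
  have h4 := h2.hasFPowerSeriesAt.apply_eq_zero N 1
  simp [ContinuousLinearMap.compFormalMultilinearSeries_apply, expSeries,
    FormalMultilinearSeries.compContinuousLinearMap] at h4
  simpa [Nat.factorial_ne_zero] using h4

-- The exponential series converges in norm and `Λ` is continuous, so `Λ` applies term by term. The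
-- factor `g` makes room for the Gaussian and twist of the kernel.
open NormedSpace in
theorem map_exp_eq_zero_of_pow (Λ : A →L[ℂ] ℂ) (x g : A)
    (h : ∀ N : ℕ, Λ (x ^ N * g) = 0) : Λ (exp x * g) = 0 := by
  have h1 := ((exp_series_hasSum_exp' (𝕂 := ℂ) x).mul_right g).mapL Λ
  simp only [smul_mul_assoc, map_smul, h, smul_zero] at h1
  exact h1.unique hasSum_zero

open NormedSpace in
/-- A functional vanishing on `exp (l a + (conj l / 2) b)` for all complex `l` vanishes on all
monomials in `a` and `b`. -/
theorem map_monomial_eq_zero_of_exp (Λ : A →L[ℂ] ℂ) (a b : A)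
    (h : ∀ l : ℂ, Λ (exp (l • a + ((starRingEnd ℂ) l / 2) • b)) = 0) (j m : ℕ) :
    Λ (a ^ j * b ^ m) = 0 := by
  -- For `|u| = 1`, multiplying `u a + (conj u / 2) b` by `u` removes the conjugate and leaves a
  -- polynomial in `u ^ 2`.
  have hpow : ∀ u : ℂ, ‖u‖ = 1 → Λ ((u ^ 2 • a + (1 / 2 : ℂ) • b) ^ (j + m)) = 0 := by
    intro u hu
    have h1 := map_pow_eq_zero_of_exp Λ (u • a + ((starRingEnd ℂ) u / 2) • b)
      (fun t => by
        rw [← h (t * u)]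
        congr 3
        simp only [smul_add, smul_smul, map_mul, Complex.conj_ofReal]
        ring_nf) (j + m)
    have h2 : u ^ 2 • a + (1 / 2 : ℂ) • b = u • (u • a + ((starRingEnd ℂ) u / 2) • b) := by
      have : u * (starRingEnd ℂ) u = 1 := by rw [Complex.mul_conj, Complex.normSq_eq_norm_sq, hu]; simp
      simp only [smul_add, smul_smul]
      congr 2
      · ring
      · rw [mul_div_assoc', this]
    rw [h2, smul_pow, map_smul, h1, smul_zero]
  -- The value of `p` at `u ^ 2` is the expansion of `hpow`, so every point of the unit circle is a
  -- root; its coefficient of index `j` is a nonzero multiple of `Λ (a ^ j * b ^ m)`.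
  let p : Polynomial ℂ := ∑ k ∈ Finset.range (j + m + 1),
    Polynomial.monomial k ((1 / 2 : ℂ) ^ (j + m - k) * (j + m).choose k * Λ (a ^ k * b ^ (j + m - k)))
  have hp : p = 0 := by
    refine Polynomial.eq_zero_of_infinite_isRoot p (Set.Infinite.mono (s := Metric.sphere 0 1) ?_ ?_)
    · intro v hv
      obtain ⟨u, rfl⟩ : ∃ u : ℂ, u ^ 2 = v := IsAlgClosed.exists_pow_nat_eq v (by norm_num)
      have hu : ‖u‖ = 1 := by
        have : ‖u‖ ^ 2 = 1 := by simpa using hv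
        exact (pow_eq_one_iff_of_nonneg (norm_nonneg _) (by norm_num)).1 this
      have := hpow u hu
      rw [add_pow, map_sum] at this
      rw [Set.mem_ofPred_eq, Polynomial.IsRoot, ← this, Polynomial.eval_finsetSum]
      refine Finset.sum_congr rfl fun k _ => ?_
      rw [Polynomial.eval_monomial, smul_pow, smul_pow, smul_mul_smul_comm, smul_mul_assoc,
        map_smul,
        ← nsmul_eq_mul' (a ^ k * b ^ (j + m - k)), map_nsmul, nsmul_eq_mul, smul_eq_mul]
      ring
    · exact (isPreconnected_sphere (E := ℂ) (by simp) 0 1).infinite_of_nontrivial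
        ⟨1, by simp, -1, by simp, by norm_num⟩
  have hc := congrArg (fun q => Polynomial.coeff q j) hp
  simp only [p, Polynomial.finsetSum_coeff, Polynomial.coeff_monomial, Polynomial.coeff_zero] at hc
  rw [Finset.sum_ite_eq' _ _ _, if_pos (by simp)] at hc
  have : ((j + m).choose j : ℂ) ≠ 0 := by exact_mod_cast (Nat.choose_pos (by omega)).ne'
  simpa [this] using hc

end BanachAlgebra

/-! ### Applying a functional to the coefficients of a polynomial -/

section Coefficients

variable {A σ : Type*} [CommRing A] [Algebra ℂ A] (Λ : A →ₗ[ℂ] ℂ)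

/-- The polynomial obtained by applying the functional `Λ` to every coefficient. -/
noncomputable def mapCoeffs (p : MvPolynomial σ A) : MvPolynomial σ ℂ :=
  AddMonoidAlgebra.map Λ.toAddMonoidHom p

theorem coeff_mapCoeffs (p : MvPolynomial σ A) (d : σ →₀ ℕ) :
    (mapCoeffs Λ p).coeff d = Λ (p.coeff d) := rfl

theorem mapCoeffs_add (p q : MvPolynomial σ A) :
    mapCoeffs Λ (p + q) = mapCoeffs Λ p + mapCoeffs Λ q := by
  ext d
  simp [coeff_mapCoeffs]

theorem mapCoeffs_sum {ι : Type*} (s : Finset ι) (f : ι → MvPolynomial σ A) :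
    mapCoeffs Λ (∑ i ∈ s, f i) = ∑ i ∈ s, mapCoeffs Λ (f i) := by
  ext d
  simp [coeff_mapCoeffs, MvPolynomial.coeff_sum]

theorem mapCoeffs_C_algebraMap_mul (c : ℂ) (p : MvPolynomial σ A) :
    mapCoeffs Λ (MvPolynomial.C (algebraMap ℂ A c) * p) = MvPolynomial.C c * mapCoeffs Λ p := by
  ext d
  simp [coeff_mapCoeffs, MvPolynomial.coeff_C_mul, ← Algebra.smul_def]

theorem pderiv_mapCoeffs (i : σ) (p : MvPolynomial σ A) :
    MvPolynomial.pderiv i (mapCoeffs Λ p) = mapCoeffs Λ (MvPolynomial.pderiv i p) := by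
  ext d
  simp only [coeff_mapCoeffs, MvPolynomial.coeff_pderiv]
  have : ((d i : A) + 1) = algebraMap ℂ A (d i + 1) := by simp
  rw [this, mul_comm (MvPolynomial.coeff _ p), ← Algebra.smul_def, map_smul, smul_eq_mul, mul_comm]

theorem eval_mapCoeffs (x : σ → ℂ) (p : MvPolynomial σ A) :
    MvPolynomial.eval x (mapCoeffs Λ p) =
      Λ (MvPolynomial.eval (fun i => algebraMap ℂ A (x i)) p) := by
  induction p using MvPolynomial.induction_on'' with
  | C a =>
    have : mapCoeffs Λ (MvPolynomial.C a : MvPolynomial σ A) = MvPolynomial.C (Λ a) := by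
      classical
      ext d
      simp only [coeff_mapCoeffs, MvPolynomial.coeff_C]
      split_ifs <;> simp
    simp [this]
  | monomial_add d a p _ _ ih ih' =>
    rw [mapCoeffs_add, map_add, map_add, map_add, ih, ih']
  | mul_X p i ih =>
    have : mapCoeffs Λ (p * MvPolynomial.X i) = mapCoeffs Λ p * MvPolynomial.X i := by
      classical
      ext d
      simp only [coeff_mapCoeffs, MvPolynomial.coeff_mul_X']
      split_ifs <;> simp
    rw [this, map_mul, map_mul, ih, MvPolynomial.eval_X, MvPolynomial.eval_X, mul_comm _ (algebraMap ℂ A _),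
      ← Algebra.smul_def, map_smul, smul_eq_mul, mul_comm]

theorem isHomogeneous_mapCoeffs {p : MvPolynomial σ A} {l : ℕ} (hp : p.IsHomogeneous l) :
    (mapCoeffs Λ p).IsHomogeneous l := by
  intro d hd
  refine hp fun h => hd ?_
  rw [coeff_mapCoeffs, h, map_zero]

end Coefficients

/-! ### Moment polynomials and their Laplacian -/

section Pairing

variable {A : Type*} [CommRing A] {n : ℕ} (a b : Fin n → A)

/-- `(∑ z_i a_i)^j (∑ \bar z_i b_i)^m` as a polynomial in `z` and `\bar z`. -/
noncomputable def pairingPoly (j m : ℕ) : MvPolynomial (Fin n ⊕ Fin n) A :=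
  (∑ i, MvPolynomial.C (a i) * MvPolynomial.X (Sum.inl i)) ^ j *
    (∑ i, MvPolynomial.C (b i) * MvPolynomial.X (Sum.inr i)) ^ m

theorem isHomogeneous_pairingPoly (j m : ℕ) : (pairingPoly a b j m).IsHomogeneous (j + m) := by
  have h (c : Fin n → A) (s : Fin n → Fin n ⊕ Fin n) :
      (∑ i, MvPolynomial.C (c i) * MvPolynomial.X (s i)).IsHomogeneous 1 := by
    refine MvPolynomial.IsHomogeneous.sum _ _ _ fun i _ => ?_
    simpa using (MvPolynomial.isHomogeneous_C (Fin n ⊕ Fin n) (c i)).mul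
      (MvPolynomial.isHomogeneous_X A (s i))
  simpa [pairingPoly] using ((h a Sum.inl).pow j).mul ((h b Sum.inr).pow m)

/-- Each mixed second derivative removes one factor from each power and leaves `j m a_i b_i`. When
`j` or `m` is `0` the truncated subtraction is harmless, as the factor `j * m` vanishes. -/
theorem sum_pderiv_pairingPoly (j m : ℕ) :
    ∑ i, MvPolynomial.pderiv (Sum.inl i) (MvPolynomial.pderiv (Sum.inr i) (pairingPoly a b j m)) =
      MvPolynomial.C ((j * m : ℕ) * ∑ i, a i * b i) * pairingPoly a b (j - 1) (m - 1) := by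
  have hl (i : Fin n) : MvPolynomial.pderiv (Sum.inl i)
      (∑ k, MvPolynomial.C (a k) * MvPolynomial.X (R := A) (Sum.inl k : Fin n ⊕ Fin n)) =
        MvPolynomial.C (a i) := by
    simp [MvPolynomial.pderiv_X, Pi.single_apply]
  have hr (i : Fin n) : MvPolynomial.pderiv (Sum.inr i)
      (∑ k, MvPolynomial.C (b k) * MvPolynomial.X (R := A) (Sum.inr k : Fin n ⊕ Fin n)) =
        MvPolynomial.C (b i) := by
    simp [MvPolynomial.pderiv_X, Pi.single_apply]
  have hlr (i : Fin n) : MvPolynomial.pderiv (Sum.inl i)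
      (∑ k, MvPolynomial.C (b k) * MvPolynomial.X (R := A) (Sum.inr k : Fin n ⊕ Fin n)) = 0 := by
    simp [MvPolynomial.pderiv_X]
  have hrl (i : Fin n) : MvPolynomial.pderiv (Sum.inr i)
      (∑ k, MvPolynomial.C (a k) * MvPolynomial.X (R := A) (Sum.inl k : Fin n ⊕ Fin n)) = 0 := by
    simp [MvPolynomial.pderiv_X]
  rw [Finset.mul_sum, map_sum, Finset.sum_mul]
  refine Finset.sum_congr rfl fun i _ => ?_
  simp only [pairingPoly, MvPolynomial.pderiv_mul, MvPolynomial.pderiv_pow, hr, hrl, hl, hlr,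
    mul_zero, zero_mul, zero_add, add_zero, MvPolynomial.pderiv_C, Derivation.map_natCast, map_mul,
    map_natCast, Nat.cast_mul]
  ring

variable [Algebra ℂ A] (Λ : A →ₗ[ℂ] ℂ)

theorem value_mapCoeffs_pairingPoly (j m : ℕ) (z : CSpace n) :
    ZPoly.value (mapCoeffs Λ (pairingPoly a b j m)) z =
      Λ ((∑ i, z i • a i) ^ j * (∑ i, (starRingEnd ℂ) (z i) • b i) ^ m) := by
  rw [ZPoly.value, eval_mapCoeffs, pairingPoly]
  simp [Algebra.smul_def, mul_comm]

theorem laplacian_mapCoeffs_pairingPoly {R : ℂ} (hR : ∑ i, a i * b i = algebraMap ℂ A R) (j m : ℕ) :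
    ZPoly.laplacian (mapCoeffs Λ (pairingPoly a b j m)) =
      MvPolynomial.C (4 * ((j * m : ℕ) * R)) * mapCoeffs Λ (pairingPoly a b (j - 1) (m - 1)) := by
  simp only [ZPoly.laplacian, pderiv_mapCoeffs]
  rw [← mapCoeffs_sum, sum_pderiv_pairingPoly, hR, ← map_natCast (algebraMap ℂ A), ← map_mul,
    mapCoeffs_C_algebraMap_mul, ← mul_assoc, ← map_mul]

/-- If all the moments `Λ ((∑ z_i a_i)^j (∑ \bar z_i b_i)^m)` vanish for `z` in a non-harmonic set,
and `∑ a_i b_i` is constant, then they vanish for all `z`. -/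
theorem moments_eq_zero_of_isNonHarmonic {C : Set (CSpace n)} (hC : IsNonHarmonic C)
    {R : ℂ} (hR : ∑ i, a i * b i = algebraMap ℂ A R)
    (h : ∀ z ∈ C, ∀ j m : ℕ,
      Λ ((∑ i, z i • a i) ^ j * (∑ i, (starRingEnd ℂ) (z i) • b i) ^ m) = 0)
    (z : CSpace n) (j m : ℕ) :
    Λ ((∑ i, z i • a i) ^ j * (∑ i, (starRingEnd ℂ) (z i) • b i) ^ m) = 0 := by
  suffices hP : ∀ j m : ℕ, mapCoeffs Λ (pairingPoly a b j m) = 0 by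
    rw [← value_mapCoeffs_pairingPoly, hP, ZPoly.value, map_zero]
  intro j
  -- Lowering `j` alone suffices, since the hypothesis is for all `m`: the Laplacian at `(j + 1, m)`
  -- is a multiple of the polynomial at `(j, m - 1)`.
  induction j with
  | zero =>
    intro m
    by_contra hne
    refine hC _ _ ⟨hne, isHomogeneous_mapCoeffs Λ (isHomogeneous_pairingPoly a b 0 m), ?_⟩
      fun z hz => ?_
    · simp [laplacian_mapCoeffs_pairingPoly a b Λ hR]
    · exact (value_mapCoeffs_pairingPoly a b Λ 0 m z).trans (h z hz 0 m)
  | succ j ih =>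
    intro m
    by_contra hne
    refine hC _ _ ⟨hne, isHomogeneous_mapCoeffs Λ (isHomogeneous_pairingPoly a b (j + 1) m), ?_⟩
      fun z hz => ?_
    · simp [laplacian_mapCoeffs_pairingPoly a b Λ hR, ih]
    · exact (value_mapCoeffs_pairingPoly a b Λ (j + 1) m z).trans (h z hz (j + 1) m)

end Pairing

/-! ### Integrals against a complex measure through Jordan decompositions -/

section ComplexMeasure

variable {X : Type*} [MeasurableSpace X]

theorem integral_signedMeasure_eq_sub (s : SignedMeasure X) {f : X → ℂ}
    (hf : Integrable f s.totalVariation) :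
    VectorMeasure.integral s f (ContinuousLinearMap.lsmul ℝ ℝ).flip =
      ∫ x, f x ∂s.toJordanDecomposition.posPart - ∫ x, f x ∂s.toJordanDecomposition.negPart := by
  obtain ⟨h1, h2⟩ := integrable_add_measure.1 hf
  conv_lhs => rw [← s.toSignedMeasure_toJordanDecomposition, JordanDecomposition.toSignedMeasure]
  rw [VectorMeasure.integral_sub_vectorMeasure, VectorMeasure.integral_toSignedMeasure,
    VectorMeasure.integral_toSignedMeasure]
  · simpa [VectorMeasure.Integrable] using h1
  · simpa [VectorMeasure.Integrable] using h2

/-- The complex measure `c • s` for a complex number `c` and a signed measure `s`. -/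
noncomputable def complexSMul (c : ℂ) (s : SignedMeasure X) : ComplexMeasure X :=
  s.mapRange (LinearMap.toAddMonoidHom ((ContinuousLinearMap.toSpanSingleton ℝ c : ℝ →L[ℝ] ℂ) : ℝ →ₗ[ℝ] ℂ))
    (ContinuousLinearMap.toSpanSingleton ℝ c).continuous

theorem complexSMul_apply (c : ℂ) (s : SignedMeasure X) (A : Set X) :
    complexSMul c s A = s A * c := by
  simp [complexSMul]

theorem variation_complexSMul_le (c : ℂ) (s : SignedMeasure X) :
    (complexSMul c s).variation ≤ (‖c‖₊ : ℝ≥0∞) • s.variation := by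
  refine VectorMeasure.variation_le_of_forall_enorm_le fun A _ => ?_
  rw [complexSMul_apply, enorm_mul, mul_comm, Measure.smul_apply, smul_eq_mul]
  gcongr
  · exact le_rfl
  · simpa [enorm_eq_nnnorm] using VectorMeasure.enorm_measure_le_variation s A

theorem integrable_complexSMul (c : ℂ) (s : SignedMeasure X) {f : X → ℂ}
    (hf : Integrable f s.totalVariation) : Integrable f (complexSMul c s).variation := by
  rw [SignedMeasure.totalVariation_eq_variation] at hf
  exact hf.of_measure_le_smul (by simp) (variation_complexSMul_le c s)

theorem integral_complexSMul (c : ℂ) (s : SignedMeasure X) {f : X → ℂ}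
    (hf : Integrable f s.totalVariation) :
    VectorMeasure.integral (complexSMul c s) f (ContinuousLinearMap.mul ℝ ℂ) =
      c * VectorMeasure.integral s f (ContinuousLinearMap.lsmul ℝ ℝ).flip := by
  rw [SignedMeasure.totalVariation_eq_variation] at hf
  have h1 := VectorMeasure.continuousLinearMap_apply_integral
    (C := ContinuousLinearMap.mul ℝ ℂ c) (B := (ContinuousLinearMap.lsmul ℝ ℝ (E := ℂ)).flip) hf
  rw [ContinuousLinearMap.mul_apply'] at h1
  rw [h1, VectorMeasure.integral_eq_setToFun, VectorMeasure.integral_eq_setToFun]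
  -- Both integrals are extensions of the same operator-valued set function, `x ↦ c * s A * x`; only
  -- the dominating variation measures differ, by a factor at most `‖c‖`.
  have hT : (complexSMul c s).transpose (ContinuousLinearMap.mul ℝ ℂ) =
      s.transpose ((ContinuousLinearMap.compL ℝ ℝ ℂ ℂ (ContinuousLinearMap.mul ℝ ℂ c)).comp
        (ContinuousLinearMap.lsmul ℝ ℝ (E := ℂ)).flip) := by
    ext A hA x
    change x * complexSMul c s A = c * (s A • x)
    rw [complexSMul_apply, Complex.real_smul]
    ring
  have hT' := congrArg (fun T : VectorMeasure X (ℂ →L[ℝ] ℂ) => (T : Set X → ℂ →L[ℝ] ℂ)) hT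
  have hdom := dominatedFinMeasAdditive_cbmApplyMeasure (complexSMul c s) (ContinuousLinearMap.mul ℝ ℂ)
  rw [setToFun_congr_measure_of_integrable (‖c‖₊ : ℝ≥0∞) (by simp) (variation_complexSMul_le c s)
    (dominatedFinMeasAdditive_cbmApplyMeasure s _) (hT' ▸ hdom) f hf]
  exact setToFun_congr_left _ _ hT' f

theorem complexSMul_re_add_complexSMul_im (μ : ComplexMeasure X) :
    complexSMul 1 (ComplexMeasure.re μ) + complexSMul Complex.I (ComplexMeasure.im μ) = μ := by
  ext A hA
  have hre : ComplexMeasure.re μ A = (μ A).re := rfl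
  have him : ComplexMeasure.im μ A = (μ A).im := rfl
  rw [add_apply, complexSMul_apply, complexSMul_apply, hre, him, mul_one,
    Complex.re_add_im]

theorem integral_complexMeasure (μ : ComplexMeasure X) {f : X → ℂ}
    (hre : Integrable f (ComplexMeasure.re μ).totalVariation)
    (him : Integrable f (ComplexMeasure.im μ).totalVariation) :
    VectorMeasure.integral μ f (ContinuousLinearMap.mul ℝ ℂ) =
      (∫ x, f x ∂(ComplexMeasure.re μ).toJordanDecomposition.posPart -
        ∫ x, f x ∂(ComplexMeasure.re μ).toJordanDecomposition.negPart) +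
      Complex.I * (∫ x, f x ∂(ComplexMeasure.im μ).toJordanDecomposition.posPart -
        ∫ x, f x ∂(ComplexMeasure.im μ).toJordanDecomposition.negPart) := by
  conv_lhs => rw [← complexSMul_re_add_complexSMul_im μ]
  rw [VectorMeasure.integral_add_vectorMeasure (integrable_complexSMul _ _ hre)
    (integrable_complexSMul _ _ him), integral_complexSMul _ _ hre, integral_complexSMul _ _ him,
    integral_signedMeasure_eq_sub _ hre, integral_signedMeasure_eq_sub _ him, one_mul]

end ComplexMeasure

/-! ### Complex measures as functionals on `C(S, ℂ)` -/

section Functional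

/-- Integration against a finite measure as a continuous functional on `C(K, ℂ)`. -/
noncomputable def integralFunctional {K : Type*} [TopologicalSpace K] [CompactSpace K]
    [MeasurableSpace K] [BorelSpace K] (m : Measure K) [IsFiniteMeasure m] : C(K, ℂ) →L[ℂ] ℂ :=
  have hint (f : C(K, ℂ)) : Integrable f m :=
    f.continuous.integrable_of_hasCompactSupport (HasCompactSupport.of_compactSpace f)
  LinearMap.mkContinuous
    { toFun := fun f => ∫ x, f x ∂m
      map_add' := fun f g => integral_add (hint f) (hint g)
      map_smul' := fun c f => integral_const_mul c f } (m.real Set.univ) fun f => by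
    rw [mul_comm]
    exact norm_integral_le_of_norm_le_const (Filter.Eventually.of_forall f.norm_coe_le_norm)

theorem integralFunctional_apply {K : Type*} [TopologicalSpace K] [CompactSpace K]
    [MeasurableSpace K] [BorelSpace K] (m : Measure K) [IsFiniteMeasure m] (f : C(K, ℂ)) :
    integralFunctional m f = ∫ x, f x ∂m := rfl

variable {X : Type*} [MeasurableSpace X]

theorem totalVariation_compl_eq_zero (s : SignedMeasure X) {S : Set X} (hS : MeasurableSet S)
    (h : ∀ A, MeasurableSet A → Disjoint A S → s A = 0) : s.totalVariation Sᶜ = 0 := by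
  rw [SignedMeasure.totalVariation_eq_variation, VectorMeasure.variation_apply_eq_zero hS.compl]
  intro A hA hAm
  exact h A (by assumption) (Set.disjoint_left.2 fun x hx => by tauto)

variable [TopologicalSpace X] [BorelSpace X] (S : Set X) [CompactSpace S]

/-- Integration over a compact set against a signed measure as a functional on `C(S, ℂ)`. -/
noncomputable def signedFunctional (s : SignedMeasure X) : C(S, ℂ) →L[ℂ] ℂ :=
  integralFunctional (s.toJordanDecomposition.posPart.comap Subtype.val) -
    integralFunctional (s.toJordanDecomposition.negPart.comap Subtype.val)

/-- Integration over a compact set against a complex measure as a functional on `C(S, ℂ)`. -/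
noncomputable def complexFunctional (μ : ComplexMeasure X) : C(S, ℂ) →L[ℂ] ℂ :=
  signedFunctional S (ComplexMeasure.re μ) + Complex.I • signedFunctional S (ComplexMeasure.im μ)

variable {S}

theorem signedFunctional_restrict (hS : MeasurableSet S) (s : SignedMeasure X)
    (h : ∀ A, MeasurableSet A → Disjoint A S → s A = 0) (g : C(X, ℂ)) :
    signedFunctional S s (g.restrict S) =
      ∫ x, g x ∂s.toJordanDecomposition.posPart - ∫ x, g x ∂s.toJordanDecomposition.negPart := by
  have h0 := totalVariation_compl_eq_zero s hS h
  rw [SignedMeasure.totalVariation, Measure.add_apply, add_eq_zero] at h0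
  have key (m : Measure X) (hm : m Sᶜ = 0) : ∫ x : S, g x ∂(m.comap Subtype.val) = ∫ x, g x ∂m := by
    rw [integral_subtype_comap hS, Measure.restrict_eq_self_of_ae_mem (mem_ae_iff.2 hm)]
  rw [signedFunctional, sub_apply, integralFunctional_apply,
    integralFunctional_apply, ← key _ h0.1, ← key _ h0.2]
  rfl

theorem integrable_totalVariation [T2Space X] (s : SignedMeasure X)
    (h : ∀ A, MeasurableSet A → Disjoint A S → s A = 0) (g : C(X, ℂ)) :
    Integrable g s.totalVariation := by
  have hS : IsCompact S := isCompact_iff_compactSpace.2 inferInstance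
  have h0 := totalVariation_compl_eq_zero s hS.measurableSet h
  rw [← Measure.restrict_eq_self_of_ae_mem (mem_ae_iff.2 h0)]
  exact g.continuous.continuousOn.integrableOn_compact hS

theorem integral_restrict_eq_complexFunctional [T2Space X] (μ : ComplexMeasure X)
    (h : ∀ A, MeasurableSet A → Disjoint A S → μ A = 0) (g : C(X, ℂ)) :
    VectorMeasure.integral (VectorMeasure.restrict μ S) g (ContinuousLinearMap.mul ℝ ℂ) =
      complexFunctional S μ (g.restrict S) := by
  have hS : MeasurableSet S := (isCompact_iff_compactSpace.2 inferInstance : IsCompact S).measurableSet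
  have hres : VectorMeasure.restrict μ S = μ := by
    ext1 A hA
    rw [VectorMeasure.restrict_apply _ hS hA]
    conv_rhs => rw [← Set.inter_union_sdiff A S, VectorMeasure.of_union
      (Set.disjoint_sdiff_right.mono_left Set.inter_subset_right) (hA.inter hS) (hA.diff hS)]
    rw [h (A \ S) (hA.diff hS) Set.disjoint_sdiff_left, add_zero]
  have hre : ∀ A, MeasurableSet A → Disjoint A S → ComplexMeasure.re μ A = 0 := fun A hA hAS => by
    rw [show ComplexMeasure.re μ A = (μ A).re from rfl, h A hA hAS, Complex.zero_re]
  have him : ∀ A, MeasurableSet A → Disjoint A S → ComplexMeasure.im μ A = 0 := fun A hA hAS => by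
    rw [show ComplexMeasure.im μ A = (μ A).im from rfl, h A hA hAS, Complex.zero_im]
  rw [hres, integral_complexMeasure μ (integrable_totalVariation _ hre g)
    (integrable_totalVariation _ him g), ← signedFunctional_restrict hS _ hre,
    ← signedFunctional_restrict hS _ him]
  rfl

/-- A signed measure is real, so conjugation passes inside the integral. This is what later
separates the real and imaginary parts of `μ`. -/
theorem conj_signedFunctional (s : SignedMeasure X) (f : C(S, ℂ)) :
    (starRingEnd ℂ) (signedFunctional S s f) = signedFunctional S s (star f) := by
  simp only [signedFunctional, sub_apply, integralFunctional_apply, map_sub,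
    ← integral_conj]
  rfl

end Functional

/-! ### Uniqueness of the Fourier transform -/

section Characters

variable {n : ℕ} {S : Set (CSpace n)} [CompactSpace S]

/-- The function `w ↦ ∑ z_j \bar w_j` on `S`. -/
noncomputable def hermitianPairing (S : Set (CSpace n)) (z : CSpace n) : C(S, ℂ) :=
  ⟨fun w => ∑ i, z i * (starRingEnd ℂ) ((w : CSpace n) i), by fun_prop⟩

/-- The character `w ↦ exp (i Re ∑ z_j \bar w_j)`. -/
noncomputable def realCharacter (z : CSpace n) : C(CSpace n, ℂ) :=
  ⟨fun w => Complex.exp ((∑ i, z i * (starRingEnd ℂ) (w i)).re * Complex.I), by fun_prop⟩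

/-- The two Jordan parts are finite measures with the same characteristic function, hence equal. -/
theorem signedMeasure_eq_zero_of_character (hS : MeasurableSet S) (s : SignedMeasure (CSpace n))
    (h : ∀ A, MeasurableSet A → Disjoint A S → s A = 0)
    (hchar : ∀ z, signedFunctional S s ((realCharacter z).restrict S) = 0) : s = 0 := by
  let _ : InnerProductSpace ℝ (CSpace n) := InnerProductSpace.complexToReal
  have heq : s.toJordanDecomposition.posPart = s.toJordanDecomposition.negPart := by
    refine Measure.ext_of_charFun (funext fun z => ?_)
    have h1 := hchar z
    rw [signedFunctional_restrict hS s h, sub_eq_zero] at h1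
    have h2 (w : CSpace n) : Complex.exp ((inner ℝ w z : ℝ) * Complex.I) = realCharacter z w := by
      change Complex.exp (((inner ℂ w z).re : ℂ) * Complex.I) = _
      simp [realCharacter, PiLp.inner_apply]
    simpa only [charFun_apply, h2] using h1
  rw [← s.toSignedMeasure_toJordanDecomposition, JordanDecomposition.toSignedMeasure]
  ext A hA
  simp [heq]

theorem complexMeasure_eq_zero_of_character (hS : MeasurableSet S) (μ : ComplexMeasure (CSpace n))
    (h : ∀ A, MeasurableSet A → Disjoint A S → μ A = 0)
    (hchar : ∀ z, complexFunctional S μ ((realCharacter z).restrict S) = 0) : μ = 0 := by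
  have hstar (z : CSpace n) : star ((realCharacter z).restrict S) = (realCharacter (-z)).restrict S := by
    ext w
    simp [realCharacter, ← Complex.exp_conj]
  -- With `A`, `B` the values of the real and imaginary parts of `μ` at the character of `z`, the
  -- hypothesis at `z` reads `A + iB = 0`, and its conjugate at `-z` reads `A - iB = 0`.
  have hboth (z : CSpace n) :
      signedFunctional S (ComplexMeasure.re μ) ((realCharacter z).restrict S) = 0 ∧
        signedFunctional S (ComplexMeasure.im μ) ((realCharacter z).restrict S) = 0 := by
    have h1 := hchar z
    have h2 := congrArg (starRingEnd ℂ) (hchar (-z))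
    simp only [complexFunctional, add_apply, smul_apply,
      smul_eq_mul, map_add, map_mul, Complex.conj_I, conj_signedFunctional, hstar, neg_neg,
      map_zero] at h1 h2
    constructor
    · linear_combination (h1 + h2) / 2
    · linear_combination (-Complex.I / 2) * (h1 - h2) +
        signedFunctional S (ComplexMeasure.im μ) ((realCharacter z).restrict S) * Complex.I_sq
  have hre := signedMeasure_eq_zero_of_character hS (ComplexMeasure.re μ) (fun A hA hAS => by
    rw [show ComplexMeasure.re μ A = (μ A).re from rfl, h A hA hAS, Complex.zero_re])
    fun z => (hboth z).1
  have him := signedMeasure_eq_zero_of_character hS (ComplexMeasure.im μ) (fun A hA hAS => by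
    rw [show ComplexMeasure.im μ A = (μ A).im from rfl, h A hA hAS, Complex.zero_im])
    fun z => (hboth z).2
  rw [← complexSMul_re_add_complexSMul_im μ, hre, him]
  ext A hA
  simp [complexSMul_apply]

end Characters

/-! ### From Laguerre polynomials to powers -/

section Laguerre

/-- A functional vanishing on `L_k(x) g` for all `k` vanishes on `x^k g` for all `k`. -/
theorem map_pow_mul_eq_zero_of_laguerre {A : Type*} [CommRing A] [Algebra ℂ A] (Λ : A →ₗ[ℂ] ℂ)
    (a : ℕ) (x g : A)
    (h : ∀ k, Λ ((∑ j ∈ Finset.range (k + 1),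
      (((a + k).choose (k - j) : ℂ) * (-1) ^ j / (j.factorial : ℂ)) • x ^ j) * g) = 0) (k : ℕ) :
    Λ (x ^ k * g) = 0 := by
  induction k using Nat.strong_induction_on with
  | _ k ih =>
    have hk := h k
    -- The system is triangular: lower powers vanish by induction, and the top coefficient `(-1)^k /
    -- k!` is nonzero.
    rw [Finset.sum_mul, map_sum, Finset.sum_range_succ, Finset.sum_eq_zero, zero_add,
      smul_mul_assoc, map_smul, smul_eq_mul] at hk
    · refine (mul_eq_zero.1 hk).resolve_left ?_
      simp [Nat.factorial_ne_zero]
    · intro j hj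
      rw [smul_mul_assoc, map_smul, ih j (Finset.mem_range.1 hj), smul_zero]

end Laguerre

/-! ### The projection kernel on the sphere -/

section Sphere

variable {n : ℕ} {S : Set (CSpace n)}

theorem hermitianPairing_smul (l : ℂ) (z : CSpace n) :
    hermitianPairing S (l • z) = l • hermitianPairing S z := by
  ext w
  simp [hermitianPairing, Finset.mul_sum, mul_assoc]

theorem hermitianPairing_eq_sum (z : CSpace n) :
    hermitianPairing S z = ∑ i, z i • (star ⟨fun w => (w : CSpace n) i, by fun_prop⟩ : C(S, ℂ)) := by
  ext w
  simp [hermitianPairing, ContinuousMap.sum_apply]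

theorem star_hermitianPairing_eq_sum (z : CSpace n) :
    star (hermitianPairing S z) =
      ∑ i, (starRingEnd ℂ) (z i) • (⟨fun w => (w : CSpace n) i, by fun_prop⟩ : C(S, ℂ)) := by
  ext w
  simp [hermitianPairing, ContinuousMap.sum_apply]

theorem exp_continuousMap_apply [CompactSpace S] (f : C(S, ℂ)) (w : S) :
    NormedSpace.exp f w = Complex.exp (f w) := by
  rw [Complex.exp_eq_exp_ℂ]
  exact NormedSpace.map_exp (ContinuousMap.evalAlgHom ℂ ℂ w) (continuous_eval_const w) f

/-- The kernel of the spectral projection as a function of the integration variable. -/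
noncomputable def projectionKernel (a k : ℕ) (z : CSpace n) : C(CSpace n, ℂ) :=
  ⟨fun w => (laguerreFun a k (z - w) : ℂ) * Complex.exp (Complex.I / 2 * (imDot z w : ℂ)), by
    unfold laguerreFun laguerrePoly imDot
    fun_prop⟩

/-- The squared distance to `z`, divided by two. -/
noncomputable def halfSqDist (S : Set (CSpace n)) (z : CSpace n) : C(S, ℂ) :=
  ⟨fun w => ((‖z - w‖ ^ 2 / 2 : ℝ) : ℂ), by fun_prop⟩

/-- The exponential factor common to the kernels of all spectral projections. -/
noncomputable def expFactor (S : Set (CSpace n)) (z : CSpace n) : C(S, ℂ) :=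
  ⟨fun w => (Real.exp (-‖z - w‖ ^ 2 / 4) : ℂ) * Complex.exp (Complex.I / 2 * (imDot z w : ℂ)), by
    unfold imDot
    fun_prop⟩

theorem projectionKernel_restrict (a k : ℕ) (z : CSpace n) :
    (projectionKernel a k z).restrict S = (∑ j ∈ Finset.range (k + 1),
      (((a + k).choose (k - j) : ℂ) * (-1) ^ j / (j.factorial : ℂ)) • halfSqDist S z ^ j) *
        expFactor S z := by
  ext w
  have h (x : ℝ) : (laguerrePoly a k x : ℂ) = ∑ j ∈ Finset.range (k + 1),
      ((a + k).choose (k - j) : ℂ) * (-1) ^ j / (j.factorial : ℂ) * (x : ℂ) ^ j := by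
    unfold laguerrePoly
    push_cast
    refine Finset.sum_congr rfl fun j _ => ?_
    rw [neg_pow]
    ring
  simp only [projectionKernel, expFactor, laguerreFun, ContinuousMap.restrict_apply,
    ContinuousMap.coe_mk, ContinuousMap.mul_apply, ContinuousMap.sum_apply,
    ContinuousMap.smul_apply, ContinuousMap.pow_apply, halfSqDist, Complex.ofReal_mul, h,
    smul_eq_mul]
  ring

theorem norm_sub_sq_eq (z w : CSpace n) :
    ‖z - w‖ ^ 2 = ‖z‖ ^ 2 + ‖w‖ ^ 2 - 2 * (∑ i, z i * (starRingEnd ℂ) (w i)).re := by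
  rw [@norm_sub_sq ℂ, ← inner_re_symm]
  simp [PiLp.inner_apply]
  ring

/-- On the sphere `|z - w|² = |z|² + r² - 2 Re c`. With `exp (-s q)` in place of `exp (-q)`, the
exponent is a constant plus `((s + 1) / 2) c + (s / 2) \bar c`. At `s = 0` the conjugate term is
lost; `s = 1` keeps both, as needed to reach every bidegree. -/
theorem exp_neg_halfSqDist_mul_expFactor {r : ℝ} [CompactSpace (Metric.sphere (0 : CSpace n) r)]
    (z : CSpace n) :
    NormedSpace.exp (-halfSqDist (Metric.sphere (0 : CSpace n) r) z) * expFactor _ z =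
      Complex.exp (-(3 / 4) * (‖z‖ ^ 2 + r ^ 2)) •
        NormedSpace.exp (hermitianPairing (Metric.sphere (0 : CSpace n) r) z +
          (1 / 2 : ℂ) • star (hermitianPairing (Metric.sphere (0 : CSpace n) r) z)) := by
  ext w
  have hw : ‖(w : CSpace n)‖ = r := by simp
  simp only [ContinuousMap.mul_apply, ContinuousMap.smul_apply, exp_continuousMap_apply, expFactor,
    ContinuousMap.coe_mk, ContinuousMap.neg_apply, ContinuousMap.add_apply, ContinuousMap.star_apply,
    smul_eq_mul, halfSqDist, Complex.ofReal_exp, ← Complex.exp_add, norm_sub_sq_eq, hw,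
    hermitianPairing, imDot]
  generalize (∑ i, z i * (starRingEnd ℂ) ((w : CSpace n) i)) = c
  congr 1
  have hc : star c = c.re - c.im * Complex.I := by
    rw [Complex.star_def]
    apply Complex.ext <;> simp
  rw [hc]
  push_cast
  linear_combination -(Complex.re_add_im c).symm

theorem exp_hermitianPairing_eq_realCharacter [CompactSpace S] (z : CSpace n) :
    (realCharacter z).restrict S = NormedSpace.exp ((Complex.I / 2) • hermitianPairing S z +
      (Complex.I / 2) • star (hermitianPairing S z)) := by
  ext w
  simp only [exp_continuousMap_apply, realCharacter, ContinuousMap.restrict_apply,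
    ContinuousMap.coe_mk, ContinuousMap.add_apply, ContinuousMap.smul_apply,
    ContinuousMap.star_apply, hermitianPairing, smul_eq_mul]
  rw [Complex.re_eq_add_conj, Complex.star_def]
  congr 1
  ring

end Sphere

/-- A complex measure supported on a sphere is zero if its spectral projections vanish on a
non-harmonic complex cone. -/
theorem eq_zero_of_spectralProjection_eq_zero {n : ℕ} {r : ℝ} {C : Set (CSpace n)}
    (hC : IsComplexCone C) (hCnh : IsNonHarmonic C) {μ : ComplexMeasure (CSpace n)}
    (hμ : ∀ A, MeasurableSet A → Disjoint A (Metric.sphere (0 : CSpace n) r) → μ A = 0)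
    (hvanish : ∀ k : ℕ, ∀ z ∈ C, spectralProjection r k μ z = 0) :
    μ = 0 := by
  set S : Set (CSpace n) := Metric.sphere (0 : CSpace n) r
  have : CompactSpace S := isCompact_iff_compactSpace.1 (isCompact_sphere 0 r)
  let Λ : C(S, ℂ) →L[ℂ] ℂ := complexFunctional S μ
  have hexp (z : CSpace n) (hz : z ∈ C) :
      Λ (NormedSpace.exp (hermitianPairing S z + (1 / 2 : ℂ) • star (hermitianPairing S z))) = 0 := by
    have hpow := map_pow_mul_eq_zero_of_laguerre Λ.toLinearMap (n - 1) (halfSqDist S z)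
      (expFactor S z) fun k => by
        rw [← projectionKernel_restrict]
        exact (integral_restrict_eq_complexFunctional μ hμ _).symm.trans (hvanish k z hz)
    have h1 : Λ (NormedSpace.exp (-halfSqDist S z) * expFactor S z) = 0 :=
      map_exp_eq_zero_of_pow Λ _ _ fun N => by
        have : (-halfSqDist S z) ^ N * expFactor S z =
            (-1 : ℂ) ^ N • (halfSqDist S z ^ N * expFactor S z) := by
          rw [← smul_mul_assoc, ← smul_pow, neg_one_smul]
        rw [this, map_smul]
        exact (congrArg _ (hpow N)).trans (smul_zero _)
    rw [exp_neg_halfSqDist_mul_expFactor, map_smul, smul_eq_mul] at h1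
    exact (mul_eq_zero.1 h1).resolve_left (Complex.exp_ne_zero _)
  have hcone (z : CSpace n) (hz : z ∈ C) (j m : ℕ) :
      Λ (hermitianPairing S z ^ j * star (hermitianPairing S z) ^ m) = 0 :=
    map_monomial_eq_zero_of_exp Λ _ _ (fun l => by
      have h1 := hexp (l • z) (hC l z hz)
      rw [hermitianPairing_smul, star_smul, smul_smul] at h1
      rw [div_eq_inv_mul, ← one_div]
      exact h1) j m
  have hall (z : CSpace n) (j m : ℕ) :
      Λ (hermitianPairing S z ^ j * star (hermitianPairing S z) ^ m) = 0 := by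
    have hR : ∑ i : Fin n, (star ⟨fun w => (w : CSpace n) i, by fun_prop⟩ : C(S, ℂ)) *
        ⟨fun w => (w : CSpace n) i, by fun_prop⟩ = algebraMap ℂ C(S, ℂ) (r ^ 2 : ℂ) := by
      ext w
      have hw : ‖(w : CSpace n)‖ = r := by simp
      have hsum := congrArg Complex.ofReal (EuclideanSpace.norm_sq_eq (w : CSpace n))
      rw [hw] at hsum
      push_cast at hsum
      simp [ContinuousMap.sum_apply, Complex.conj_mul', hsum]
    have := moments_eq_zero_of_isNonHarmonic _ _ Λ.toLinearMap hCnh hR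
      (fun z hz j m => by
        rw [← hermitianPairing_eq_sum, ← star_hermitianPairing_eq_sum]
        exact hcone z hz j m) z j m
    rwa [← hermitianPairing_eq_sum, ← star_hermitianPairing_eq_sum] at this
  refine complexMeasure_eq_zero_of_character Metric.isClosed_sphere.measurableSet μ hμ
    fun z => ?_
  rw [exp_hermitianPairing_eq_realCharacter, ← mul_one (NormedSpace.exp _)]
  refine map_exp_eq_zero_of_pow Λ _ _ fun N => ?_
  -- By the binomial formula every power of the exponent is a combination of the vanishing moments
  -- in `hall`.
  rw [mul_one, add_pow, map_sum]
  refine Finset.sum_eq_zero fun k _ => ?_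
  rw [smul_pow, smul_pow, smul_mul_smul_comm, smul_mul_assoc, map_smul, ← nsmul_eq_mul', map_nsmul,
    hall, smul_zero, smul_zero]

end SpectralProjection

theorem theorem5p4 (n : ℕ) (hn : 1 ≤ n) (r : ℝ) (hr : 0 < r)
    (C : Set (SpectralProjection.CSpace n))
    (hC : SpectralProjection.IsComplexCone C)
    (hCnh : SpectralProjection.IsNonHarmonic C)
    (μ : MeasureTheory.ComplexMeasure (SpectralProjection.CSpace n))
    (hμ : SpectralProjection.MemX r μ)
    (hvanish : ∀ k : ℕ, ∀ z ∈ C, SpectralProjection.spectralProjection r k μ z = 0) :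
    μ = 0 := by
  exact SpectralProjection.eq_zero_of_spectralProjection_eq_zero hC hCnh hμ.supported hvanish
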